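/- Let $\gamma>1$ be a real number and let $\theta_k = e^{-k^\gamma}$ for $k\ge 1$. For $n \ge 1$ and a permutation $\sigma$ in the symmetric group $\mathcal S_n$, let $R_j(\sigma)$ denote the number of cycles of length $j$ of $\sigma$ (fixed points being cycles of length $1$). Let $\mathbb P_n$ be the probability distribution on $\mathcal S_n$ given by $$\mathbb P_n(\sigma) = \frac{1}{n!\,h_n}\prod_{k\ge 1}\theta_k^{R_k(\sigma)}, \qquad h_n = \frac1{n!}\sum_{\sigma\in\mathcal S_n}\prod_{k\ge1}\theta_k^{R_k(\sigma)},$$ and let $\mathbb E_n$ denote the corresponding expectation. Then, for each fixed integer $j\ge 1$, as $n\to\infty$, $$\mathbb E_n(R_j) = \exp\Bigl\{ j\gamma\Bigl(\frac{\log n}{\gamma-1}\Bigr)^{\frac{\gamma-1}{\gamma}} + o\Bigl((\log n)^{\frac{\gamma-1}{\gamma}}\Bigr)\Bigr\}.$$ -/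

import Mathlib

open Filter Asymptotics

noncomputable section

namespace WeightedPerm

/-- The number `R_j(σ)` of cycles of length `j` of a permutation `σ` of `n` elements. Fixed points
are cycles of length `1`: `σ.partition` is the full cycle type of `σ`, a partition of `n`. -/
def cycleCount {n : ℕ} (j : ℕ) (σ : Equiv.Perm (Fin n)) : ℕ :=
  σ.partition.parts.count j

/-- The weight `∏_{j ≥ 1} θ_j ^ R_j(σ)`. All cycles have length between `1` and `n`, so the other
factors are equal to `1`. -/
def weight (θ : ℕ → ℝ) {n : ℕ} (σ : Equiv.Perm (Fin n)) : ℝ :=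
  ∏ j ∈ Finset.Icc 1 n, θ j ^ cycleCount j σ

/-- The normalization `h_n = (1 / n!) ∑_σ ∏_j θ_j ^ R_j(σ)`. -/
def h (θ : ℕ → ℝ) (n : ℕ) : ℝ :=
  1 / (n.factorial : ℝ) * ∑ σ : Equiv.Perm (Fin n), weight θ σ

/-- The probability `ℙ_n(σ) = (1 / (n! h_n)) ∏_j θ_j ^ R_j(σ)` of the permutation `σ`. -/
def prob (θ : ℕ → ℝ) {n : ℕ} (σ : Equiv.Perm (Fin n)) : ℝ :=
  1 / ((n.factorial : ℝ) * h θ n) * weight θ σ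

/-- The expectation `𝔼_n(X)` of a random variable `X` on the permutations of `n` elements. -/
def expect (θ : ℕ → ℝ) (n : ℕ) (X : Equiv.Perm (Fin n) → ℝ) : ℝ :=
  ∑ σ : Equiv.Perm (Fin n), prob θ σ * X σ

/-- The parameters `θ_k = exp (-k ^ γ)`. -/
def superExpDecay (γ : ℝ) (k : ℕ) : ℝ :=
  Real.exp (-((k : ℝ) ^ γ))

end WeightedPerm

end

/-!
Write `hₙ` for the normalization and `θₖ = exp (-k ^ γ)`. Sorting permutations by cycle type, the
removal of one part `j` from a partition of `n` gives `𝔼ₙ(R_j) = (θ_j / j) * h_{n-j} / hₙ`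
(`expect_cycleCount`) and, since the cycle lengths add up to `n`, the recurrence
`n * hₙ = ∑_{k=1}^n θₖ * h_{n-k}` (`mul_h_eq_sum`). It remains to find the logarithmic size of the
ratio `ρₙ = h_{n-1} / hₙ`.

No contour integration is needed, because `ρₙ` is increasing: `1, θ₁, θ₂, …` is log-concave by
convexity of `k ↦ k ^ γ`, and by a theorem of Bender and Canfield this passes to the coefficients of
`exp (∑ₖ θₖ * t ^ k / k)` (`monotone_ratio_of_logConcave`). The induction step of that theorem is a
weighted Chebyshev inequality applied to the recurrence.

Let `K` be given by `(γ - 1) * K ^ γ = log n` (`saddleIndex`). Dividing the recurrence by `hₙ` and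
using monotonicity, `n ≤ ∑ₖ θₖ * ρₙ ^ k`. By Young's inequality
`k ^ γ ≥ γ * K ^ (γ - 1) * k - log n`, so this is impossible if `log ρₙ < γ * K ^ (γ - 1) - 1`
(`log_ratio_ge`). Conversely the single term `θₖ * ρₙ ^ k ≤ n + k - 1`, coming from the recurrence for
`h_{n-1+k}`, gives with `k = ⌈K⌉` the bound
`log ρₙ ≤ (γ - 1) * K ^ (γ - 1) + (K + 1) ^ (γ - 1) + 1` (`log_ratio_le`). Hence
`log ρₙ ~ γ * K ^ (γ - 1)`, and `h_{n-j} / hₙ`, a product of `j` consecutive ratios, has logarithm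
`j * γ * K ^ (γ - 1) + o(K ^ (γ - 1))` (`isLittleO_log_h_sub_div`).
-/

namespace WeightedPerm

open Finset Topology

/-! ### Cycle types and the recurrence for the normalization -/

/-- The order `∏ₖ k ^ mₖ * mₖ!` of the centralizer of a permutation with full cycle type `s`, where
`mₖ` is the multiplicity of `k` in `s`. -/
def centralizerOrder (s : Multiset ℕ) : ℕ :=
  s.prod * ∏ k ∈ s.toFinset, (s.count k).factorial

lemma prod_factorial_count_of_subset {s : Multiset ℕ} {T : Finset ℕ} (hT : s.toFinset ⊆ T) :
    ∏ k ∈ s.toFinset, (s.count k).factorial = ∏ k ∈ T, (s.count k).factorial := by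
  refine prod_subset hT fun k _ hk => ?_
  rw [Multiset.count_eq_zero.2 (by simpa using hk), Nat.factorial_zero]

lemma centralizerOrder_cons (j : ℕ) (s : Multiset ℕ) :
    centralizerOrder (j ::ₘ s) = j * (s.count j + 1) * centralizerOrder s := by
  have h1 : s.toFinset ⊆ insert j s.toFinset := subset_insert _ _
  have h2 : (j ::ₘ s).toFinset = insert j s.toFinset := Multiset.toFinset_cons _ _
  unfold centralizerOrder
  rw [prod_factorial_count_of_subset h1, h2,
    ← mul_prod_erase _ _ (mem_insert_self j s.toFinset),
    ← mul_prod_erase (insert j s.toFinset) (fun k => (s.count k).factorial)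
      (mem_insert_self j s.toFinset), Multiset.count_cons_self, Nat.factorial_succ,
    Multiset.prod_cons]
  have h3 : ∏ x ∈ (insert j s.toFinset).erase j, (Multiset.count x (j ::ₘ s)).factorial =
      ∏ x ∈ (insert j s.toFinset).erase j, (Multiset.count x s).factorial := by
    refine prod_congr rfl fun x hx => ?_
    rw [Multiset.count_cons_of_ne (ne_of_mem_erase hx)]
  rw [h3]
  ring

lemma centralizerOrder_pos {s : Multiset ℕ} (hs : ∀ i ∈ s, 0 < i) : 0 < centralizerOrder s := by
  refine Nat.mul_pos (Nat.pos_of_ne_zero ?_) (prod_pos fun k _ => Nat.factorial_pos _)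
  rw [Ne, Multiset.prod_eq_zero_iff]
  exact fun h0 => (hs 0 h0).false

lemma centralizerOrder_add_replicate_one {m : Multiset ℕ} (hm : 1 ∉ m) (k : ℕ) :
    centralizerOrder (m + Multiset.replicate k 1) =
      k.factorial * m.prod * ∏ i ∈ m.toFinset, (m.count i).factorial := by
  induction k with
  | zero => simp [centralizerOrder]
  | succ k ih =>
    rw [Multiset.replicate_succ, Multiset.add_cons, centralizerOrder_cons, ih,
      Multiset.count_add, Multiset.count_eq_zero.2 hm, Multiset.count_replicate_self,
      Nat.factorial_succ]
    ring

lemma partition_parts_eq (n : ℕ) (p : n.Partition) :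
    p.parts = p.parts.filter (2 ≤ ·) + Multiset.replicate (p.parts.count 1) 1 := by
  conv_lhs => rw [← Multiset.filter_add_not (2 ≤ ·) p.parts]
  congr 1
  rw [← Multiset.filter_eq']
  refine Multiset.filter_congr fun x hx => ?_
  have := p.parts_pos hx
  omega

/-- The number of permutations with a given full cycle type. Mathlib's count
`Equiv.Perm.card_of_cycleType_mul_eq` is in terms of the cycles of length at least `2`; the fixed
points contribute the factor for parts equal to `1`. -/
lemma card_partition_fiber_mul {α : Type*} [Fintype α] [DecidableEq α]
    (p : (Fintype.card α).Partition) :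
    #{σ : Equiv.Perm α | σ.partition = p} * centralizerOrder p.parts =
      (Fintype.card α).factorial := by
  set m := p.parts.filter (2 ≤ ·) with hm
  have hp := partition_parts_eq _ p
  rw [← hm] at hp
  have hsum : m.sum + p.parts.count 1 = Fintype.card α := by
    have := congrArg Multiset.sum hp
    rw [p.parts_sum, Multiset.sum_add, Multiset.sum_replicate] at this
    simpa using this.symm
  have hfib : ∀ σ : Equiv.Perm α, σ.partition = p ↔ σ.cycleType = m := by
    intro σ
    constructor
    · rintro rfl
      rw [hm, Equiv.Perm.filter_parts_partition_eq_cycleType]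
    · intro h
      ext1
      rw [Equiv.Perm.parts_partition, h, hp]
      congr 2
      rw [← Equiv.Perm.sum_cycleType, h]
      omega
  have h2 := Equiv.Perm.card_of_cycleType_mul_eq α m
  rw [if_pos ⟨by omega, fun a ha => (Multiset.mem_filter.1 ha).2⟩] at h2
  rw [filter_congr fun σ _ => hfib σ, ← h2]
  congr 1
  rw [hp, centralizerOrder_add_replicate_one (by simp [hm])]
  congr 3
  omega

/-- Sums of class functions over the permutations of `n` elements are sums over the partitions
of `n`. -/
lemma sum_perm_eq_sum_partition {n : ℕ} {α : Type*} [Fintype α] [DecidableEq α]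
    (hn : Fintype.card α = n) (f : Multiset ℕ → ℝ) :
    ∑ σ : Equiv.Perm α, f σ.partition.parts =
      n.factorial * ∑ p : n.Partition, f p.parts / centralizerOrder p.parts := by
  subst hn
  rw [← sum_fiberwise univ (fun σ : Equiv.Perm α => σ.partition), mul_sum]
  refine sum_congr rfl fun p _ => ?_
  have h1 : ∀ σ ∈ univ.filter (fun σ : Equiv.Perm α => σ.partition = p),
      f σ.partition.parts = f p.parts := by
    intro σ hσ
    rw [(mem_filter.1 hσ).2]
  have h0 : (centralizerOrder p.parts : ℝ) ≠ 0 :=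
    Nat.cast_ne_zero.2 (centralizerOrder_pos fun i hi => p.parts_pos hi).ne'
  rw [sum_congr rfl h1, sum_const, nsmul_eq_mul, ← card_partition_fiber_mul p]
  push_cast
  field_simp

lemma weight_eq_prod_map (θ : ℕ → ℝ) {n : ℕ} (σ : Equiv.Perm (Fin n)) :
    weight θ σ = (σ.partition.parts.map θ).prod := by
  rw [prod_multiset_map_count]
  unfold weight cycleCount
  symm
  refine prod_subset (fun k hk => ?_) fun k _ hk => ?_
  · rw [Multiset.mem_toFinset] at hk
    have h1 := σ.partition.parts_pos hk
    have h2 := Multiset.le_sum_of_mem hk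
    rw [σ.partition.parts_sum, Fintype.card_fin] at h2
    exact mem_Icc.2 ⟨h1, h2⟩
  · rw [Multiset.count_eq_zero.2 (by simpa using hk), pow_zero]

lemma h_eq_sum_partition (θ : ℕ → ℝ) (n : ℕ) :
    h θ n = ∑ p : n.Partition, (p.parts.map θ).prod / centralizerOrder p.parts := by
  unfold h
  simp_rw [weight_eq_prod_map]
  rw [sum_perm_eq_sum_partition (Fintype.card_fin n) fun s => (s.map θ).prod]
  have := Nat.cast_ne_zero (R := ℝ) |>.2 n.factorial_ne_zero
  field_simp

/-- Removing one part equal to `j` is a bijection from the partitions of `n` with a part `j` to the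
partitions of `n - j`. It divides the centralizer order by `j` times the multiplicity of `j`. -/
lemma sum_partition_count (θ : ℕ → ℝ) {n j : ℕ} (hj : 1 ≤ j) (hjn : j ≤ n) :
    ∑ p : n.Partition, (j * p.parts.count j : ℝ) * (p.parts.map θ).prod / centralizerOrder p.parts =
      θ j * ∑ q : (n - j).Partition, (q.parts.map θ).prod / centralizerOrder q.parts := by
  rw [mul_sum]
  symm
  refine sum_of_injOn (fun q => ⟨j ::ₘ q.parts, ?_, ?_⟩) ?_ ?_ ?_ ?_
  · intro i hi
    rcases Multiset.mem_cons.1 hi with rfl | hi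
    · exact hj
    · exact q.parts_pos hi
  · rw [Multiset.sum_cons, q.parts_sum]
    omega
  · intro q _ q' _ hqq
    ext1
    simpa using hqq
  · intro q _
    simp
  · intro p _ hp
    have hjp : j ∉ p.parts := by
      intro hjp
      refine hp ?_
      refine ⟨⟨p.parts.erase j, fun hi => p.parts_pos (Multiset.mem_of_mem_erase hi), ?_⟩, by simp,
        ?_⟩
      · have := Multiset.sum_erase hjp
        rw [p.parts_sum] at this
        omega
      · ext1
        exact Multiset.cons_erase hjp
    simp [Multiset.count_eq_zero.2 hjp]
  · intro q _
    have h0 : (centralizerOrder q.parts : ℝ) ≠ 0 :=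
      Nat.cast_ne_zero.2 (centralizerOrder_pos fun i hi => q.parts_pos hi).ne'
    have hj0 : (j : ℝ) ≠ 0 := by positivity
    rw [centralizerOrder_cons, Multiset.map_cons, Multiset.prod_cons, Multiset.count_cons_self]
    push_cast
    have : (q.parts.count j : ℝ) + 1 ≠ 0 := by positivity
    field_simp

lemma sum_cycleCount_mul_weight (θ : ℕ → ℝ) {n j : ℕ} (hj : 1 ≤ j) (hjn : j ≤ n) :
    ∑ σ : Equiv.Perm (Fin n), (j * cycleCount j σ : ℝ) * weight θ σ =
      n.factorial * (θ j * h θ (n - j)) := by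
  simp_rw [weight_eq_prod_map, cycleCount]
  rw [sum_perm_eq_sum_partition (Fintype.card_fin n)
    (fun s => (j * s.count j : ℝ) * (s.map θ).prod), sum_partition_count θ hj hjn,
    h_eq_sum_partition]

/-- The lengths of the cycles of a permutation of `n` elements add up to `n`. -/
lemma sum_mul_cycleCount {n : ℕ} (σ : Equiv.Perm (Fin n)) :
    ∑ j ∈ Icc 1 n, j * cycleCount j σ = n := by
  have h1 := σ.partition.parts_sum.trans (Fintype.card_fin n)
  rw [← Multiset.map_id σ.partition.parts, sum_multiset_map_count] at h1
  conv_rhs => rw [← h1]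
  symm
  unfold cycleCount
  simp only [id, smul_eq_mul]
  simp_rw [mul_comm]
  refine sum_subset (fun k hk => ?_) fun k _ hk => ?_
  · rw [Multiset.mem_toFinset] at hk
    have h1 := σ.partition.parts_pos hk
    have h2 := Multiset.le_sum_of_mem hk
    rw [σ.partition.parts_sum, Fintype.card_fin] at h2
    exact mem_Icc.2 ⟨h1, h2⟩
  · rw [Multiset.count_eq_zero.2 (by simpa using hk), mul_zero]

lemma sum_weight_eq (θ : ℕ → ℝ) (n : ℕ) :
    ∑ σ : Equiv.Perm (Fin n), weight θ σ = n.factorial * h θ n := by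
  have := Nat.cast_ne_zero (R := ℝ) |>.2 n.factorial_ne_zero
  unfold h
  field_simp

/-- The recurrence obtained by differentiating `∑ₙ h n * t ^ n = exp (∑ₖ θ k * t ^ k / k)`. -/
lemma mul_h_eq_sum (θ : ℕ → ℝ) (n : ℕ) :
    n * h θ n = ∑ k ∈ range n, θ (k + 1) * h θ (n - 1 - k) := by
  have hf := Nat.cast_ne_zero (R := ℝ) |>.2 n.factorial_ne_zero
  refine mul_left_cancel₀ hf ?_
  have h1 : ∑ k ∈ range n, θ (k + 1) * h θ (n - 1 - k) = ∑ j ∈ Icc 1 n, θ j * h θ (n - j) := by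
    have h2 := sum_Ico_add' (fun j => θ j * h θ (n - j)) 0 n 1
    rw [zero_add, Ico_add_one_right_eq_Icc] at h2
    rw [← h2, range_eq_Ico]
    refine sum_congr rfl fun k _ => ?_
    rw [Nat.sub_sub, add_comm 1 k]
  rw [h1, mul_sum]
  have h2 : ∀ j ∈ Icc 1 n, (n.factorial : ℝ) * (θ j * h θ (n - j)) =
      ∑ σ : Equiv.Perm (Fin n), (j * cycleCount j σ : ℝ) * weight θ σ := by
    intro j hj
    rw [mem_Icc] at hj
    exact (sum_cycleCount_mul_weight θ hj.1 hj.2).symm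
  rw [sum_congr rfl h2, sum_comm, mul_left_comm, ← sum_weight_eq, mul_sum]
  refine sum_congr rfl fun σ _ => ?_
  rw [← sum_mul]
  congr 1
  exact_mod_cast (sum_mul_cycleCount σ).symm

lemma expect_cycleCount (θ : ℕ → ℝ) {n j : ℕ} (hj : 1 ≤ j) (hjn : j ≤ n) :
    expect θ n (fun σ => (cycleCount j σ : ℝ)) = θ j / j * (h θ (n - j) / h θ n) := by
  have hf := Nat.cast_ne_zero (R := ℝ) |>.2 n.factorial_ne_zero
  have hj0 : (j : ℝ) ≠ 0 := by positivity
  have h1 := sum_cycleCount_mul_weight θ hj hjn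
  have h2 : expect θ n (fun σ => (cycleCount j σ : ℝ)) =
      1 / (n.factorial * h θ n) / j *
        ∑ σ : Equiv.Perm (Fin n), (j * cycleCount j σ : ℝ) * weight θ σ := by
    rw [mul_sum]
    refine sum_congr rfl fun σ _ => ?_
    unfold prob
    field_simp
  rw [h2, h1]
  by_cases hh : h θ n = 0
  · simp [hh]
  · field_simp

lemma h_pos {θ : ℕ → ℝ} (hθ : ∀ k, 0 < θ k) (n : ℕ) : 0 < h θ n := by
  refine mul_pos (by positivity) (sum_pos (fun σ _ => prod_pos fun j _ => ?_) univ_nonempty)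
  exact pow_pos (hθ j) _

/-! ### Log-concavity of the coefficients of an exponential -/

/-- A weighted form of Chebyshev's sum inequality. -/
lemma sum_mul_sum_le_of_cross {ι : Type*} [LinearOrder ι] (s : Finset ι) {X Y D B : ι → ℝ}
    (hXY : ∀ i ∈ s, ∀ k ∈ s, i ≤ k → Y k * X i ≤ X k * Y i)
    (hDB : ∀ i ∈ s, ∀ k ∈ s, i ≤ k → D i * B k ≤ D k * B i) :
    (∑ k ∈ s, Y k * D k) * ∑ i ∈ s, X i * B i ≤ (∑ k ∈ s, X k * D k) * ∑ i ∈ s, Y i * B i := by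
  have h1 : ∀ i ∈ s, ∀ k ∈ s, 0 ≤ (X k * Y i - Y k * X i) * (D k * B i - D i * B k) := by
    intro i hi k hk
    rcases le_total i k with h | h
    · exact mul_nonneg (sub_nonneg.2 (hXY i hi k hk h)) (sub_nonneg.2 (hDB i hi k hk h))
    · refine mul_nonneg_of_nonpos_of_nonpos ?_ ?_
      · linarith [hXY k hk i hi h, mul_comm (Y k) (X i), mul_comm (Y i) (X k)]
      · linarith [hDB k hk i hi h]
  have h2 := sum_nonneg fun k hk => sum_nonneg fun i hi => h1 i hi k hk
  have h3 : ∑ k ∈ s, ∑ i ∈ s, (X k * Y i - Y k * X i) * (D k * B i - D i * B k) =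
      2 * ((∑ k ∈ s, X k * D k) * (∑ i ∈ s, Y i * B i) -
        (∑ k ∈ s, Y k * D k) * ∑ i ∈ s, X i * B i) := by
    have e : ∀ k i, (X k * Y i - Y k * X i) * (D k * B i - D i * B k) =
        ((X k * D k) * (Y i * B i) - (Y k * D k) * (X i * B i)) +
        ((X i * D i) * (Y k * B k) - (Y i * D i) * (X k * B k)) := fun k i => by ring
    simp_rw [e, sum_add_distrib, sum_sub_distrib]
    rw [sum_comm (f := fun k i => (X i * D i) * (Y k * B k)),
      sum_comm (f := fun k i => (Y i * D i) * (X k * B k))]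
    simp_rw [← mul_sum, ← sum_mul]
    ring
  linarith

variable {X A : ℕ → ℝ}

/-- One step of the proof of log-concavity: if `A` is log-concave up to `n + 1`, then also at the
next place. -/
lemma sq_ge_of_logConcave_prefix (hX0 : X 0 = 1)
    (hXc : ∀ i k, i ≤ k → X (k + 1) * X i ≤ X k * X (i + 1))
    (hA : ∀ n, 0 < A n)
    (hrec : ∀ n : ℕ, n * A n = ∑ k ∈ range n, X (k + 1) * A (n - 1 - k)) (n : ℕ)
    (ih : ∀ i k, i ≤ k → k ≤ n → A i * A (k + 1) ≤ A (i + 1) * A k) :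
    A n * A (n + 2) ≤ A (n + 1) * A (n + 1) := by
  -- `B k = A (n - k)` with the convention `A (-1) = 0` at `k = n + 1`, and
  -- `D k = A (n + 1 - k) * A n - A (n - k) * A (n + 1)`. Chebyshev's inequality applies because
  -- `X (k + 1) / X k` decreases in `k` while `D k / B k` increases.
  let B : ℕ → ℝ := fun k => if k ≤ n then A (n - k) else 0
  let C : ℕ → ℝ := fun k => A (n + 1 - k)
  let D : ℕ → ℝ := fun k => C k * A n - B k * A (n + 1)
  have hBn : B (n + 1) = 0 := by simp [B]
  have hB : ∀ k ∈ range (n + 1), B k = A (n - k) := fun k hk => by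
    simp only [mem_range] at hk
    simp [B, show k ≤ n by omega]
  have hB0 : B 0 = A n := by simp [B]
  have hC0 : C 0 = A (n + 1) := by simp [C]
  have hCB : ∀ k, C (k + 1) = A (n - k) := fun k => by simp [C]
  have r1 : ((n : ℝ) + 1) * A (n + 1) = ∑ k ∈ range (n + 1), X (k + 1) * A (n - k) := by
    have := hrec (n + 1)
    push_cast at this
    simpa using this
  have r2 : ((n : ℝ) + 2) * A (n + 2) = ∑ k ∈ range (n + 2), X (k + 1) * C k := by
    have := hrec (n + 2)
    push_cast at this
    simpa [C] using this
  have s1 : ∑ k ∈ range (n + 2), X (k + 1) * B k = (n + 1) * A (n + 1) := by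
    rw [sum_range_succ, hBn, mul_zero, add_zero, r1]
    exact sum_congr rfl fun k hk => by rw [hB k hk]
  have s2 : ∑ k ∈ range (n + 2), X k * B k = (n + 1) * A n := by
    rw [sum_range_succ, hBn, mul_zero, add_zero, sum_range_succ', hB0, hX0]
    have := hrec n
    have e : ∑ k ∈ range n, X (k + 1) * B (k + 1) = ∑ k ∈ range n, X (k + 1) * A (n - 1 - k) := by
      refine sum_congr rfl fun k hk => ?_
      rw [mem_range] at hk
      rw [hB (k + 1) (by rw [mem_range]; omega), Nat.sub_sub, add_comm 1 k]
    rw [e, ← this]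
    ring
  have s3 : ∑ k ∈ range (n + 2), X k * C k = (n + 2) * A (n + 1) := by
    rw [sum_range_succ', hC0, hX0]
    simp_rw [hCB]
    rw [← r1]
    ring
  have t1 : ∑ k ∈ range (n + 2), X (k + 1) * D k =
      (n + 2) * A (n + 2) * A n - (n + 1) * A (n + 1) * A (n + 1) := by
    rw [r2, ← s1, sum_mul, sum_mul, ← sum_sub_distrib]
    exact sum_congr rfl fun k _ => by simp only [D]; ring
  have t2 : ∑ k ∈ range (n + 2), X k * D k = A (n + 1) * A n := by
    have : ∑ k ∈ range (n + 2), X k * D k =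
        (n + 2) * A (n + 1) * A n - (n + 1) * A n * A (n + 1) := by
      rw [← s3, ← s2, sum_mul, sum_mul, ← sum_sub_distrib]
      exact sum_congr rfl fun k _ => by simp only [D]; ring
    rw [this]
    ring
  have key := sum_mul_sum_le_of_cross (range (n + 2)) (X := X) (Y := fun k => X (k + 1))
    (D := D) (B := B) (fun i _ k _ h => hXc i k h) (by
      intro i hi k hk hik
      rw [mem_range] at hi hk
      -- the terms with the factor `A (n + 1)` cancel
      suffices C i * B k ≤ C k * B i by
        have := mul_le_mul_of_nonneg_right this (hA n).le
        simp only [D]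
        nlinarith
      by_cases hkn : k ≤ n
      · have := ih (n - k) (n - i) (by omega) (by omega)
        simp only [B, C, hkn, hik.trans hkn, if_true]
        rw [show n + 1 - i = n - i + 1 by omega, show n + 1 - k = n - k + 1 by omega, mul_comm]
        exact this
      · have : B k = 0 := by simp [B, hkn]
        rw [this, mul_zero]
        refine mul_nonneg (hA _).le ?_
        simp only [B]
        split_ifs
        exacts [(hA _).le, le_rfl])
  rw [t1, t2, s1, s2] at key
  have hp : 0 < ((n : ℝ) + 1) * A n := mul_pos (by positivity) (hA n)
  have k2 : (n + 2) * A (n + 2) * A n - (n + 1) * A (n + 1) * A (n + 1) ≤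
      A (n + 1) * A (n + 1) := by
    refine le_of_mul_le_mul_right (key.trans_eq ?_) hp
    ring
  have hn2 : (0 : ℝ) < n + 2 := by positivity
  refine le_of_mul_le_mul_left ?_ hn2
  linarith

/-- If `1 = X 0, X 1, X 2, …` is log-concave, then so is the sequence of coefficients of
`exp (∑ₖ X k * t ^ k / k)` (a theorem of Bender and Canfield). Equivalently, the ratios
`A n / A (n + 1)` increase. -/
theorem monotone_ratio_of_logConcave (hX0 : X 0 = 1)
    (hXc : ∀ i k, i ≤ k → X (k + 1) * X i ≤ X k * X (i + 1))
    (hA : ∀ n, 0 < A n)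
    (hrec : ∀ n : ℕ, n * A n = ∑ k ∈ range n, X (k + 1) * A (n - 1 - k)) :
    Monotone fun n => A n / A (n + 1) := by
  have key : ∀ n, A n * A (n + 2) ≤ A (n + 1) * A (n + 1) := by
    intro n
    induction n using Nat.strong_induction_on with
    | _ n ih =>
      refine sq_ge_of_logConcave_prefix hX0 hXc hA hrec n fun i k hik hkn => ?_
      induction k, hik using Nat.le_induction with
      | base => exact (mul_comm _ _).le
      | succ k hik ihk =>
        have h1 := ihk (by omega)
        have h2 := ih k (by omega)
        refine le_of_mul_le_mul_right ?_ (mul_pos (hA k) (hA (k + 1)))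
        calc A i * A (k + 1 + 1) * (A k * A (k + 1))
            = (A i * A (k + 1)) * (A k * A (k + 2)) := by ring
          _ ≤ (A (i + 1) * A k) * (A (k + 1) * A (k + 1)) :=
            mul_le_mul h1 h2 (mul_pos (hA _) (hA _)).le (mul_pos (hA _) (hA _)).le
          _ = _ := by ring
  refine monotone_nat_of_le_succ fun n => ?_
  rw [div_le_div_iff₀ (hA _) (hA _)]
  exact key n

/-! ### Bounds for products of monotone ratios -/

lemma le_pow_mul_of_monotone_ratio {A : ℕ → ℝ} (hA : ∀ n, 0 < A n)
    (hmono : Monotone fun n => A n / A (n + 1)) {N : ℕ} (m l : ℕ) (hN : m + l ≤ N + 1) :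
    A m ≤ (A N / A (N + 1)) ^ l * A (m + l) := by
  induction l with
  | zero => simp
  | succ l ih =>
    refine (ih (by omega)).trans ?_
    rw [pow_succ, mul_assoc]
    refine mul_le_mul_of_nonneg_left ?_ (pow_pos (div_pos (hA _) (hA _)) _).le
    have := hmono (show m + l ≤ N by omega)
    simp only at this
    rwa [div_le_iff₀ (hA _)] at this

lemma pow_mul_le_of_monotone_ratio {A : ℕ → ℝ} (hA : ∀ n, 0 < A n)
    (hmono : Monotone fun n => A n / A (n + 1)) (m l : ℕ) :
    (A m / A (m + 1)) ^ l * A (m + l) ≤ A m := by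
  induction l with
  | zero => simp
  | succ l ih =>
    refine le_trans ?_ ih
    rw [pow_succ, mul_assoc]
    refine mul_le_mul_of_nonneg_left ?_ (pow_pos (div_pos (hA _) (hA _)) _).le
    have := hmono (show m ≤ m + l by omega)
    simp only at this
    rwa [le_div_iff₀ (hA _)] at this

/-! ### The parameters `exp (-k ^ γ)` -/

variable {γ : ℝ}

lemma superExpDecay_pos (γ : ℝ) (k : ℕ) : 0 < superExpDecay γ k := Real.exp_pos _

lemma superExpDecay_zero (hγ : 1 < γ) : superExpDecay γ 0 = 1 := by
  have : γ ≠ 0 := by positivity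
  simp [superExpDecay, Real.zero_rpow this]

lemma superExpDecay_logConcave (hγ : 1 < γ) (i k : ℕ) (hik : i ≤ k) :
    superExpDecay γ (k + 1) * superExpDecay γ i ≤ superExpDecay γ k * superExpDecay γ (i + 1) := by
  unfold superExpDecay
  rw [← Real.exp_add, ← Real.exp_add, Real.exp_le_exp]
  push_cast
  -- `i + 1` and `k` are the convex combinations of `i` and `k + 1` with exchanged weights
  have hc := convexOn_rpow hγ.le
  have hik' : (i : ℝ) ≤ k := by exact_mod_cast hik
  have hi0 : (0 : ℝ) ≤ i := by positivity
  set d : ℝ := k + 1 - i with hd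
  have hd1 : 1 ≤ d := by linarith
  have hd0 : 0 < d := by linarith
  have hw : 0 ≤ 1 / d := by positivity
  have hw' : 0 ≤ 1 - 1 / d := by
    rw [sub_nonneg, div_le_one hd0]
    exact hd1
  have hi : (i : ℝ) ∈ Set.Ici (0 : ℝ) := hi0
  have hk : (k : ℝ) + 1 ∈ Set.Ici (0 : ℝ) := by
    simp only [Set.mem_Ici]
    positivity
  have c1 := hc.2 hi hk hw' hw (by ring)
  have c2 := hc.2 hi hk hw hw' (by ring)
  simp only [smul_eq_mul] at c1 c2
  have e1 : (1 - 1 / d) * (i : ℝ) + 1 / d * (k + 1) = i + 1 := by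
    rw [show (k : ℝ) + 1 = i + d by rw [hd]; ring]
    field_simp
    ring
  have e2 : 1 / d * (i : ℝ) + (1 - 1 / d) * (k + 1) = k := by
    rw [show (k : ℝ) = i + d - 1 by rw [hd]; ring]
    field_simp
    ring
  rw [e1] at c1
  rw [e2] at c2
  linarith

lemma h_superExpDecay_pos (γ : ℝ) (n : ℕ) : 0 < h (superExpDecay γ) n :=
  h_pos (superExpDecay_pos γ) n

lemma monotone_h_ratio (hγ : 1 < γ) :
    Monotone fun n => h (superExpDecay γ) n / h (superExpDecay γ) (n + 1) :=
  monotone_ratio_of_logConcave (superExpDecay_zero hγ) (superExpDecay_logConcave hγ)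
    (h_superExpDecay_pos γ) (mul_h_eq_sum _)

/-- The tangent inequality for `k ^ γ` at `K`, i.e. Young's inequality. -/
lemma mul_rpow_sub_one_le (hγ : 1 < γ) {k K : ℝ} (hk : 0 ≤ k) (hK : 0 ≤ K) :
    γ * K ^ (γ - 1) * k ≤ k ^ γ + (γ - 1) * K ^ γ := by
  have hg : 0 < γ - 1 := by linarith
  have hpq : γ.HolderConjugate (γ / (γ - 1)) := Real.HolderConjugate.conjExponent hγ
  have := Real.young_inequality_of_nonneg hk (Real.rpow_nonneg hK (γ - 1)) hpq
  rw [← Real.rpow_mul hK, mul_div_cancel₀ _ hg.ne'] at this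
  have h2 := mul_le_mul_of_nonneg_left this (show 0 ≤ γ by linarith)
  have e : γ * (k ^ γ / γ + K ^ γ / (γ / (γ - 1))) = k ^ γ + (γ - 1) * K ^ γ := by
    field_simp
  rw [e] at h2
  linarith

lemma sum_exp_neg_lt_one (n : ℕ) : ∑ k ∈ range n, Real.exp (-((k : ℝ) + 1)) < 1 := by
  have h1 : ∀ m : ℕ, ∑ k ∈ range m, Real.exp (-((k : ℝ) + 1)) ≤ 1 - (1 / 2) ^ m := by
    intro m
    induction m with
    | zero => simp
    | succ m ih =>
      have h2 : Real.exp (-((m : ℝ) + 1)) ≤ (1 / 2) ^ (m + 1) := by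
        have h3 : Real.exp (-((m : ℝ) + 1)) = Real.exp (-1) ^ (m + 1) := by
          rw [← Real.exp_nat_mul]
          push_cast
          ring_nf
        rw [h3]
        refine pow_le_pow_left₀ (Real.exp_pos _).le ?_ _
        rw [Real.exp_neg, one_div]
        refine inv_anti₀ (by norm_num) ?_
        linarith [Real.add_one_le_exp (1 : ℝ)]
      rw [sum_range_succ]
      rw [pow_succ] at h2 ⊢
      linarith
  have : (0 : ℝ) < (1 / 2) ^ n := by positivity
  linarith [h1 n]

/-! ### Two-sided bounds for the ratios -/

/-- The maximizer `K` of `k ↦ k * log r - k ^ γ` at the saddle point `r`, where the maximum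
`(γ - 1) * K ^ γ` is `log n`. -/
noncomputable def saddleIndex (γ : ℝ) (n : ℕ) : ℝ :=
  (Real.log n / (γ - 1)) ^ (1 / γ)

lemma saddleIndex_nonneg (hγ : 1 < γ) (n : ℕ) : 0 ≤ saddleIndex γ n :=
  Real.rpow_nonneg (div_nonneg (Real.log_natCast_nonneg n) (by linarith)) _

lemma saddleIndex_rpow (hγ : 1 < γ) (n : ℕ) :
    (γ - 1) * saddleIndex γ n ^ γ = Real.log n := by
  have hg : 0 < γ - 1 := by linarith
  unfold saddleIndex
  rw [← Real.rpow_mul (div_nonneg (Real.log_natCast_nonneg n) hg.le),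
    one_div_mul_cancel (by linarith), Real.rpow_one]
  field_simp

lemma saddleIndex_rpow_sub_one (hγ : 1 < γ) (n : ℕ) :
    saddleIndex γ n ^ (γ - 1) = (Real.log n / (γ - 1)) ^ ((γ - 1) / γ) := by
  have hg : 0 < γ - 1 := by linarith
  unfold saddleIndex
  rw [← Real.rpow_mul (div_nonneg (Real.log_natCast_nonneg n) hg.le)]
  congr 1
  ring

/-- Since the ratios increase, the recurrence gives `n ≤ ∑ₖ θ k * r ^ k` for the last ratio `r`. This
forces the lower bound: otherwise every term is at most `n * exp (-k)`. -/
lemma log_ratio_ge (hγ : 1 < γ) (N : ℕ) :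
    γ * saddleIndex γ (N + 1) ^ (γ - 1) - 1 ≤
      Real.log (h (superExpDecay γ) N / h (superExpDecay γ) (N + 1)) := by
  by_contra! hlt
  set θ := superExpDecay γ
  set K := saddleIndex γ (N + 1) with hK
  have hK0 : 0 ≤ K := saddleIndex_nonneg hγ _
  have hpos := h_superExpDecay_pos γ
  set r := h θ N / h θ (N + 1) with hr
  have hr0 : 0 < r := div_pos (hpos _) (hpos _)
  have hN0 : (0 : ℝ) < N + 1 := by positivity
  have hlog : (γ - 1) * K ^ γ = Real.log ((N : ℝ) + 1) := by
    rw [hK, saddleIndex_rpow hγ]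
    push_cast
    rfl
  have hterm : ∀ k ∈ range (N + 1), θ (k + 1) * h θ (N + 1 - 1 - k) ≤
      Real.exp (-((k : ℝ) + 1)) * ((N + 1) * h θ (N + 1)) := by
    intro k hk
    rw [mem_range] at hk
    have h1 : h θ (N + 1 - 1 - k) ≤ r ^ (k + 1) * h θ (N + 1) := by
      have := le_pow_mul_of_monotone_ratio hpos (monotone_h_ratio hγ) (N := N)
        (N + 1 - 1 - k) (k + 1) (by omega)
      rwa [show N + 1 - 1 - k + (k + 1) = N + 1 by omega] at this
    have h2 : θ (k + 1) * r ^ (k + 1) ≤ Real.exp (-((k : ℝ) + 1)) * (N + 1) := by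
      have e1 : θ (k + 1) = Real.exp (-((k : ℝ) + 1) ^ γ) := by
        simp only [θ, superExpDecay]
        push_cast
        rfl
      have e2 : ((N : ℝ) + 1) = Real.exp ((γ - 1) * K ^ γ) := by rw [hlog, Real.exp_log hN0]
      rw [e1, e2, ← Real.exp_log hr0, ← Real.exp_nat_mul, ← Real.exp_add, ← Real.exp_add,
        Real.exp_le_exp]
      have hk0 : (0 : ℝ) < k + 1 := by positivity
      have hy := mul_rpow_sub_one_le hγ hk0.le hK0
      have hx : ((k : ℝ) + 1) * Real.log r ≤ (k + 1) * (γ * K ^ (γ - 1) - 1) :=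
        mul_le_mul_of_nonneg_left hlt.le hk0.le
      push_cast
      linarith
    calc θ (k + 1) * h θ (N + 1 - 1 - k) ≤ θ (k + 1) * (r ^ (k + 1) * h θ (N + 1)) :=
          mul_le_mul_of_nonneg_left h1 (superExpDecay_pos γ _).le
      _ = (θ (k + 1) * r ^ (k + 1)) * h θ (N + 1) := by ring
      _ ≤ (Real.exp (-((k : ℝ) + 1)) * (N + 1)) * h θ (N + 1) :=
          mul_le_mul_of_nonneg_right h2 (hpos _).le
      _ = _ := by ring
  have hrec := mul_h_eq_sum θ (N + 1)
  have hs := sum_le_sum hterm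
  rw [← hrec, ← sum_mul] at hs
  push_cast at hs
  have hp : 0 < ((N : ℝ) + 1) * h θ (N + 1) := mul_pos hN0 (hpos _)
  have := mul_lt_mul_of_pos_right (sum_exp_neg_lt_one (N + 1)) hp
  linarith

/-- The upper bound comes from a single term of the recurrence for `h (N + k)`. -/
lemma mul_log_ratio_le (hγ : 1 < γ) (N : ℕ) {k : ℕ} (hk : 1 ≤ k) :
    k * Real.log (h (superExpDecay γ) N / h (superExpDecay γ) (N + 1)) ≤
      Real.log (N + 1 : ℕ) + k + (k : ℝ) ^ γ := by
  set θ := superExpDecay γ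
  have hpos := h_superExpDecay_pos γ
  set r := h θ N / h θ (N + 1) with hr
  have hr0 : 0 < r := div_pos (hpos _) (hpos _)
  have h1 : r ^ k * h θ (N + k) ≤ h θ N :=
    pow_mul_le_of_monotone_ratio hpos (monotone_h_ratio hγ) N k
  have h2 : θ k * h θ N ≤ (N + k) * h θ (N + k) := by
    have hrec := mul_h_eq_sum θ (N + k)
    push_cast at hrec
    rw [hrec]
    have := single_le_sum (f := fun i => θ (i + 1) * h θ (N + k - 1 - i)) (s := range (N + k))
      (fun i _ => (mul_pos (superExpDecay_pos γ _) (hpos _)).le)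
      (mem_range.2 (show k - 1 < N + k by omega))
    rwa [show N + k - 1 - (k - 1) = N by omega, show k - 1 + 1 = k by omega] at this
  have h3 : θ k * r ^ k ≤ (N + k : ℝ) := by
    refine le_of_mul_le_mul_right ?_ (hpos (N + k))
    rw [mul_assoc]
    exact (mul_le_mul_of_nonneg_left h1 (superExpDecay_pos γ _).le).trans h2
  -- replacing `N + k` by `(N + 1) * k` separates the two variables in the logarithm
  have h4 : (N + k : ℝ) ≤ ((N + 1 : ℕ) : ℝ) * k := by
    have : N + k ≤ (N + 1) * k := by nlinarith
    exact_mod_cast this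
  have hk0 : (0 : ℝ) < k := by exact_mod_cast hk
  have h5 := Real.log_le_log (mul_pos (superExpDecay_pos γ k) (pow_pos hr0 k)) (h3.trans h4)
  rw [Real.log_mul (superExpDecay_pos γ k).ne' (pow_pos hr0 k).ne', Real.log_pow,
    Real.log_mul (by positivity) hk0.ne'] at h5
  have h6 : Real.log (superExpDecay γ k) = -((k : ℝ) ^ γ) := Real.log_exp _
  rw [h6] at h5
  linarith [Real.log_le_self hk0.le]

lemma log_ratio_le (hγ : 1 < γ) (N : ℕ) (hK : 0 < saddleIndex γ (N + 1)) :
    Real.log (h (superExpDecay γ) N / h (superExpDecay γ) (N + 1)) ≤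
      (γ - 1) * saddleIndex γ (N + 1) ^ (γ - 1) + (saddleIndex γ (N + 1) + 1) ^ (γ - 1) + 1 := by
  have hg : 0 < γ - 1 := by linarith
  set K := saddleIndex γ (N + 1) with hKdef
  set k := ⌈K⌉₊ with hk
  have hk1 : 1 ≤ k := Nat.ceil_pos.2 hK
  have hk0 : (0 : ℝ) < k := by exact_mod_cast hk1
  have hKk : K ≤ k := Nat.le_ceil K
  have hkK : (k : ℝ) ≤ K + 1 := (Nat.ceil_lt_add_one hK.le).le
  have h1 := mul_log_ratio_le hγ N hk1
  rw [← saddleIndex_rpow hγ (N + 1), ← hKdef] at h1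
  have e1 : K ^ γ = K ^ (γ - 1) * K := by
    rw [← Real.rpow_add_one hK.ne', sub_add_cancel]
  have e2 : (k : ℝ) ^ γ = (k : ℝ) ^ (γ - 1) * k := by
    rw [← Real.rpow_add_one hk0.ne', sub_add_cancel]
  have h2 : (k : ℝ) ^ (γ - 1) ≤ (K + 1) ^ (γ - 1) := Real.rpow_le_rpow hk0.le hkK hg.le
  have hKp : 0 ≤ (γ - 1) * K ^ (γ - 1) := mul_nonneg hg.le (Real.rpow_nonneg hK.le _)
  refine le_of_mul_le_mul_left ?_ hk0
  rw [e1, e2] at h1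
  have h3 := mul_le_mul_of_nonneg_left hKk hKp
  have h4 := mul_le_mul_of_nonneg_left h2 hk0.le
  linarith

/-! ### Asymptotics -/

lemma tendsto_saddleIndex (hγ : 1 < γ) : Tendsto (saddleIndex γ) atTop atTop := by
  have hg : 0 < γ - 1 := by linarith
  exact (tendsto_rpow_atTop (by positivity : 0 < 1 / γ)).comp
    ((Real.tendsto_log_atTop.comp tendsto_natCast_atTop_atTop).atTop_div_const hg)

/-- The bounds for single ratios give bounds for `h (n - j) / h n`, a product of `j` of them. -/
lemma log_h_sub_div_bounds (hγ : 1 < γ) {n j : ℕ} (hj : 1 ≤ j) (hjn : j ≤ n)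
    (hK : 0 < saddleIndex γ n) :
    j * (γ * ((Real.log n - Real.log j) / (γ - 1)) ^ ((γ - 1) / γ) - 1) ≤
        Real.log (h (superExpDecay γ) (n - j) / h (superExpDecay γ) n) ∧
      Real.log (h (superExpDecay γ) (n - j) / h (superExpDecay γ) n) ≤
        j * ((γ - 1) * saddleIndex γ n ^ (γ - 1) + (saddleIndex γ n + 1) ^ (γ - 1) + 1) := by
  have hg : 0 < γ - 1 := by linarith
  have hpos := h_superExpDecay_pos γ
  have hj0 : (0 : ℝ) < j := by exact_mod_cast hj
  have hn0 : (0 : ℝ) < n := by exact_mod_cast hj.trans hjn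
  constructor
  · have h1 := pow_mul_le_of_monotone_ratio hpos (monotone_h_ratio hγ) (n - j) j
    rw [Nat.sub_add_cancel hjn, ← le_div_iff₀ (hpos _)] at h1
    have h2 := Real.log_le_log (pow_pos (div_pos (hpos _) (hpos _)) _) h1
    rw [Real.log_pow] at h2
    refine le_trans (mul_le_mul_of_nonneg_left ?_ hj0.le) h2
    refine le_trans ?_ (log_ratio_ge hγ (n - j))
    rw [saddleIndex_rpow_sub_one hγ]
    refine sub_le_sub_right (mul_le_mul_of_nonneg_left ?_ (by linarith)) 1
    have h3 : Real.log n - Real.log j ≤ Real.log (n - j + 1 : ℕ) := by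
      rw [← Real.log_div hn0.ne' hj0.ne']
      refine Real.log_le_log (by positivity) ?_
      -- `n / j ≤ n - j + 1` for `1 ≤ j ≤ n`
      rw [div_le_iff₀ hj0]
      obtain ⟨m, rfl⟩ := Nat.exists_eq_add_of_le hjn
      have : j + m ≤ (j + m - j + 1) * j := by
        rw [Nat.add_sub_cancel_left]
        nlinarith
      exact_mod_cast this
    have h4 : 0 ≤ Real.log n - Real.log j :=
      sub_nonneg.2 (Real.log_le_log hj0 (by exact_mod_cast hjn))
    exact Real.rpow_le_rpow (div_nonneg h4 hg.le) (div_le_div_of_nonneg_right h3 hg.le)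
      (by positivity)
  · obtain ⟨N, rfl⟩ : ∃ N, n = N + 1 := ⟨n - 1, by omega⟩
    have h1 := le_pow_mul_of_monotone_ratio hpos (monotone_h_ratio hγ) (N := N) (N + 1 - j) j
      (by omega)
    rw [Nat.sub_add_cancel hjn, ← div_le_iff₀ (hpos _)] at h1
    have h2 := Real.log_le_log (div_pos (hpos _) (hpos _)) h1
    rw [Real.log_pow] at h2
    exact h2.trans (mul_le_mul_of_nonneg_left (log_ratio_le hγ N hK) hj0.le)

/-- The logarithmic asymptotics of `h (n - j) / h n`, up to any additive constant. -/
lemma isLittleO_log_h_sub_div (hγ : 1 < γ) {j : ℕ} (hj : 1 ≤ j) (c : ℝ) :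
    (fun n : ℕ => c + Real.log (h (superExpDecay γ) (n - j) / h (superExpDecay γ) n) -
      j * γ * saddleIndex γ n ^ (γ - 1)) =o[atTop] fun n => saddleIndex γ n ^ (γ - 1) := by
  have hg : 0 < γ - 1 := by linarith
  have hK := tendsto_saddleIndex hγ
  have hKp : ∀ᶠ n in atTop, 0 < saddleIndex γ n := hK.eventually_gt_atTop 0
  have hu : Tendsto (fun n => (saddleIndex γ n ^ (γ - 1))⁻¹) atTop (𝓝 0) :=
    tendsto_inv_atTop_zero.comp ((tendsto_rpow_atTop hg).comp hK)
  have hlog : Tendsto (fun n : ℕ => Real.log n) atTop atTop :=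
    Real.tendsto_log_atTop.comp tendsto_natCast_atTop_atTop
  have hA : Tendsto (fun n => (1 + (saddleIndex γ n)⁻¹) ^ (γ - 1)) atTop (𝓝 1) := by
    have h1 : Tendsto (fun n => 1 + (saddleIndex γ n)⁻¹) atTop (𝓝 1) := by
      simpa using (tendsto_inv_atTop_zero.comp hK).const_add 1
    simpa using h1.rpow_const (p := γ - 1) (Or.inr hg.le)
  have hB : Tendsto (fun n : ℕ => (1 - Real.log j * (Real.log n)⁻¹) ^ ((γ - 1) / γ)) atTop
      (𝓝 1) := by
    have h1 : Tendsto (fun n : ℕ => 1 - Real.log j * (Real.log n)⁻¹) atTop (𝓝 1) := by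
      simpa using ((tendsto_inv_atTop_zero.comp hlog).const_mul (Real.log j)).const_sub 1
    simpa using h1.rpow_const (p := (γ - 1) / γ) (Or.inr (by positivity))
  rw [isLittleO_iff_tendsto' (by
    filter_upwards [hKp] with n hn h0
    exact absurd h0 (Real.rpow_pos_of_pos hn _).ne')]
  have hlow : Tendsto (fun n : ℕ => c * (saddleIndex γ n ^ (γ - 1))⁻¹ +
      j * (γ * (1 - Real.log j * (Real.log n)⁻¹) ^ ((γ - 1) / γ) - γ -
        (saddleIndex γ n ^ (γ - 1))⁻¹)) atTop (𝓝 0) := by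
    have := (hu.const_mul c).add ((((hB.const_mul γ).sub_const γ).sub hu).const_mul (j : ℝ))
    simpa using this
  have hupp : Tendsto (fun n : ℕ => c * (saddleIndex γ n ^ (γ - 1))⁻¹ +
      j * ((1 + (saddleIndex γ n)⁻¹) ^ (γ - 1) - 1 + (saddleIndex γ n ^ (γ - 1))⁻¹)) atTop
      (𝓝 0) := by
    have := (hu.const_mul c).add (((hA.sub_const 1).add hu).const_mul (j : ℝ))
    simpa using this
  refine tendsto_of_tendsto_of_tendsto_of_le_of_le' hlow hupp ?_ ?_
  · filter_upwards [hKp, eventually_ge_atTop j, hlog.eventually_gt_atTop 0] with n hn hjn hln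
    have hb := (log_h_sub_div_bounds hγ hj hjn hn).1
    have hup := Real.rpow_pos_of_pos hn (γ - 1)
    have h4 : 0 ≤ Real.log n - Real.log j :=
      sub_nonneg.2 (Real.log_le_log (by exact_mod_cast hj) (by exact_mod_cast hjn))
    have e : ((Real.log n - Real.log j) / (γ - 1)) ^ ((γ - 1) / γ) =
        (1 - Real.log j * (Real.log n)⁻¹) ^ ((γ - 1) / γ) * saddleIndex γ n ^ (γ - 1) := by
      have e2 : 1 - Real.log j * (Real.log n)⁻¹ = (Real.log n - Real.log j) / Real.log n := by
        field_simp
      rw [saddleIndex_rpow_sub_one hγ, e2,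
        ← Real.mul_rpow (div_nonneg h4 hln.le) (div_nonneg hln.le hg.le)]
      congr 1
      field_simp
    rw [e] at hb
    rw [le_div_iff₀ hup]
    set u := saddleIndex γ n ^ (γ - 1)
    have hc : u⁻¹ * u = 1 := inv_mul_cancel₀ hup.ne'
    linear_combination hb + (c - j) * hc
  · filter_upwards [hKp, eventually_ge_atTop j] with n hn hjn
    have hb := (log_h_sub_div_bounds hγ hj hjn hn).2
    have hup := Real.rpow_pos_of_pos hn (γ - 1)
    have e : (saddleIndex γ n + 1) ^ (γ - 1) =
        (1 + (saddleIndex γ n)⁻¹) ^ (γ - 1) * saddleIndex γ n ^ (γ - 1) := by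
      rw [← Real.mul_rpow (by positivity) hn.le]
      congr 1
      field_simp
    rw [e] at hb
    rw [div_le_iff₀ hup]
    set u := saddleIndex γ n ^ (γ - 1)
    have hc : u⁻¹ * u = 1 := inv_mul_cancel₀ hup.ne'
    linear_combination hb - (c + j) * hc

end WeightedPerm

theorem mainTheorem6 (γ : ℝ) (hγ : 1 < γ) (j : ℕ) (hj : 1 ≤ j) :
    ∃ ε : ℕ → ℝ,
      (ε =o[atTop] fun n : ℕ => Real.log (n : ℝ) ^ ((γ - 1) / γ)) ∧
      ∀ᶠ n : ℕ in atTop,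
        WeightedPerm.expect (WeightedPerm.superExpDecay γ) n
            (fun σ => (WeightedPerm.cycleCount j σ : ℝ)) =
          Real.exp ((j : ℝ) * γ * (Real.log (n : ℝ) / (γ - 1)) ^ ((γ - 1) / γ) + ε n) := by
  have hg : 0 < γ - 1 := by linarith
  have hpos := WeightedPerm.h_superExpDecay_pos γ
  have hc0 : 0 < WeightedPerm.superExpDecay γ j / j :=
    div_pos (WeightedPerm.superExpDecay_pos γ j) (by exact_mod_cast hj)
  refine ⟨_, (WeightedPerm.isLittleO_log_h_sub_div hγ hj
    (Real.log (WeightedPerm.superExpDecay γ j / j))).trans_isBigO ?_, ?_⟩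
  · refine IsBigO.of_bound (((γ - 1) ^ ((γ - 1) / γ))⁻¹) (Eventually.of_forall fun n => ?_)
    rw [WeightedPerm.saddleIndex_rpow_sub_one hγ,
      Real.div_rpow (Real.log_natCast_nonneg n) hg.le, norm_div, div_eq_inv_mul,
      Real.norm_of_nonneg (Real.rpow_nonneg hg.le _)]
  · filter_upwards [eventually_ge_atTop j] with n hjn
    have hr0 := div_pos (hpos (n - j)) (hpos n)
    rw [WeightedPerm.expect_cycleCount _ hj hjn, ← WeightedPerm.saddleIndex_rpow_sub_one hγ,
      add_sub_cancel, Real.exp_add, Real.exp_log hc0, Real.exp_log hr0]
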